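/- Let $X$ be an infinite-dimensional Banach space over $\mathbb K=\mathbb R$ or $\mathbb C$. For $0<p<\infty$ let $\ell_p(X)$ be the space of all sequences $(x_n)_{n\ge 1}$ in $X$ with $\|(x_n)\|_p=\left(\sum_n\|x_n\|^p\right)^{1/p}<\infty$, with the topology given by $\|\cdot\|_p$ (a norm for $p\ge 1$; for $p<1$ the topology of the metric $\|x-y\|_p^p$). Let $c_0(X)$ be the space of norm-null sequences in $X$ with the sup norm, and, for $1\le p<\infty$, let $\ell_p(X)^+=\bigcap_{q>p}\ell_q(X)$ with the topology generated by the norms $\|\cdot\|_q$, $q>p$. Write $\dim$ for the (Hamel) dimension. A subset $A$ of a topological vector space $E$ is called maximal-spaceable if $A\cup\{0\}$ contains a closed linear subspace of $E$ of dimension $\dim E$. Then $\dim \ell_p(X)=\dim X$ for $0<p<\infty$, $\dim c_0(X)=\dim X$, $\dim \ell_p(X)^+=\dim X$ for $1\le p<\infty$, and the following hold: (a) $\ell_p(X)\setminus\bigcup_{0<q<p}\ell_q(X)$ is maximal-spaceable in $\ell_p(X)$ for every $0<p<\infty$; (b) $c_0(X)\setminus\bigcup_{q>0}\ell_q(X)$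 is maximal-spaceable in $c_0(X)$; (c) $\ell_p(X)^+\setminus\ell_p(X)$ is maximal-spaceable in $\ell_p(X)^+$ for every $1\le p<\infty$. In particular, each of these sets together with $0$ contains a closed subspace of dimension $\dim X$. -/

import Mathlib

open scoped NNReal ENNReal Topology ZeroAtInfty

noncomputable section

/-- `A ⊆ E` is `μ`-spaceable for the topology `τ` on `E`: the set `A ∪ {0}` contains a `τ`-closed
linear subspace whose (Hamel) dimension is `μ`. -/
def IsSpaceable (𝕜 : Type*) {E : Type*} [Field 𝕜] [AddCommGroup E] [Module 𝕜 E]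
    (τ : TopologicalSpace E) (μ : Cardinal) (A : Set E) : Prop :=
  ∃ W : Submodule 𝕜 E, IsClosed[τ] (W : Set E) ∧ Module.rank 𝕜 W = μ ∧ (W : Set E) ⊆ A ∪ {0}

/-- `A ⊆ E` is maximal-spaceable if it is `μ`-spaceable with `μ = dim E`. -/
def IsMaximalSpaceable (𝕜 : Type*) {E : Type*} [Field 𝕜] [AddCommGroup E] [Module 𝕜 E]
    (τ : TopologicalSpace E) (A : Set E) : Prop :=
  IsSpaceable 𝕜 τ (Module.rank 𝕜 E) A

/-- The space `ℓ_p(X)` of `X`-valued sequences with `∑ ‖x_n‖ ^ p < ∞` (for real `p > 0`). Mathlib's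
`Norm` on it is `(∑ ‖x_n‖ ^ p) ^ (1 / p)`, also when `p < 1`. -/
abbrev EllP (X : Type*) [NormedAddCommGroup X] (p : ℝ≥0) : Type _ :=
  lp (fun _ : ℕ => X) (p : ℝ≥0∞)

/-- The usual topology of `ℓ_p(X)`, for every `0 < p < ∞`: a set is open if with each point `x` it
contains some ball `{y | ‖y - x‖_p < ε}`. For `p < 1` these balls are the balls of the metric
`‖y - x‖_p ^ p`. -/
@[reducible]
def ellPTopology (X : Type*) [NormedAddCommGroup X] (p : ℝ≥0) : TopologicalSpace (EllP X p) where
  IsOpen U := ∀ x ∈ U, ∃ ε : ℝ, 0 < ε ∧ ∀ y : EllP X p, ‖y - x‖ < ε → y ∈ U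
  isOpen_univ := fun _ _ => ⟨1, one_pos, fun _ _ => trivial⟩
  isOpen_inter := by
    rintro U V hU hV x ⟨hxU, hxV⟩
    obtain ⟨a, ha, hUa⟩ := hU x hxU
    obtain ⟨b, hb, hVb⟩ := hV x hxV
    exact ⟨min a b, lt_min ha hb, fun y hy =>
      ⟨hUa y (hy.trans_le (min_le_left a b)), hVb y (hy.trans_le (min_le_right a b))⟩⟩
  isOpen_sUnion := by
    rintro S hS x ⟨U, hUS, hxU⟩
    obtain ⟨ε, hε, h⟩ := hS U hUS x hxU
    exact ⟨ε, hε, fun y hy => ⟨U, hUS, h y hy⟩⟩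

/-- For `p ≥ 1` the topology above is the norm topology of Mathlib's `lp`. -/
theorem ellPTopology_eq_norm (X : Type*) [NormedAddCommGroup X] (p : ℝ≥0)
    [Fact (1 ≤ (p : ℝ≥0∞))] :
    ellPTopology X p = (inferInstance : TopologicalSpace (EllP X p)) := by
  ext U
  rw [Metric.isOpen_iff]
  change (∀ x ∈ U, ∃ ε : ℝ, 0 < ε ∧ ∀ y : EllP X p, ‖y - x‖ < ε → y ∈ U) ↔ _
  simp only [Set.subset_def, mem_ball_iff_norm, gt_iff_lt]

/-- The space `ℓ_p(X)⁺ = ⋂_{q > p} ℓ_q(X)`. -/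
def ellPlus (𝕜 X : Type*) [RCLike 𝕜] [NormedAddCommGroup X] [NormedSpace 𝕜 X] (p : ℝ≥0) :
    Submodule 𝕜 (PreLp fun _ : ℕ => X) :=
  ⨅ q : {q : ℝ≥0 // p < q}, lpSubmodule 𝕜 (fun _ : ℕ => X) (q.1 : ℝ≥0∞)

/-- The inclusion of `ℓ_p(X)⁺` in `ℓ_q(X)`, for `q > p`. -/
def ellPlusIncl (𝕜 X : Type*) [RCLike 𝕜] [NormedAddCommGroup X] [NormedSpace 𝕜 X] (p : ℝ≥0)
    (q : {q : ℝ≥0 // p < q}) (x : ellPlus 𝕜 X p) : EllP X q.1 :=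
  ⟨x.1, (Submodule.mem_iInf _).1 x.2 q⟩

/-- The topology of `ℓ_p(X)⁺` generated by all the norms `‖·‖_q`, `q > p`. -/
@[reducible]
def ellPlusTopology (𝕜 X : Type*) [RCLike 𝕜] [NormedAddCommGroup X] [NormedSpace 𝕜 X] (p : ℝ≥0) :
    TopologicalSpace (ellPlus 𝕜 X p) :=
  ⨅ q : {q : ℝ≥0 // p < q}, TopologicalSpace.induced (ellPlusIncl 𝕜 X p q) (ellPTopology X q.1)

end

/-!
Each of the three spaces `E` consists of `X`-valued sequences, and both assertions reduce to facts
about `X` and about scalar sequences.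

*Dimension.* In an infinite-dimensional Banach space the Hamel dimension is the number of
sequences of points (`rank_eq_cardinalMk_nat_fun`). Hence the dimension of `E`, at most the number
of its elements, is at most `dim X`. Two facts give this equality. First, let `S` be a maximal
`1`-separated set in a ball; by Riesz' lemma its span is dense, so `#X ≤ #S ^ ℵ₀`, while
`s ↦ ∑ n, 8⁻ⁿ s n` embeds the sequences in `S` into `X`. Thus `#X = #S ^ ℵ₀ = #X ^ ℵ₀`
(`cardinalMk_nat_fun_eq`). Second, `dim X ≥ #𝕜` (`lift_cardinalMk_le_rank`), so that `#X = dim X`.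

*Closed subspaces.* If `a` is a sequence of positive numbers for which every `(a n • x)` lies in
`E`, these sequences form a copy of `X` in `E`. It is closed, since it is cut out by the equations
`a 0 • y n = a n • y 0` in the coordinates, and it has the dimension of `X`, which is that of `E`
(`rank_eq_and_isMaximalSpaceable`). For `x ≠ 0`, the sequence `(a n • x)` lies in `ℓ_q(X)` exactly
if `a` lies in `ℓ_q`. So it is enough to have one scalar sequence for each of the three cases:
in `ℓ_p` and in no smaller `ℓ_q`, of order `(n log² n) ^ (-1 / p)`; null and in no `ℓ_q`, of order
`1 / log n`; in every `ℓ_q` with `q > p` but not in `ℓ_p`, of order `n ^ (-1 / p)`.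
-/

open scoped NNReal ENNReal Topology ZeroAtInfty

universe u v

/-! ### Hamel dimension and cardinality of a Banach space -/

theorem RCLike.cardinalMk_le_continuum (𝕜 : Type*) [RCLike 𝕜] :
    Cardinal.mk 𝕜 ≤ Cardinal.continuum := by
  have h : Function.Injective fun z : 𝕜 => (RCLike.re z, RCLike.im z) := fun z w hzw =>
    RCLike.ext (congrArg Prod.fst hzw) (congrArg Prod.snd hzw)
  have := Cardinal.lift_mk_le_lift_mk_of_injective h
  simpa [Cardinal.mk_real] using this

/-- Biorthogonality in one direction comes from a greedy choice: finitely many functionals have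
a common nonzero kernel vector. -/
theorem exists_triangular_system {𝕜 X : Type*} [RCLike 𝕜] [NormedAddCommGroup X] [NormedSpace 𝕜 X]
    (hX : ¬ FiniteDimensional 𝕜 X) :
    ∃ (e : ℕ → X) (f : ℕ → StrongDual 𝕜 X), (∀ n, ‖e n‖ = 1) ∧ (∀ n, f n (e n) = 1) ∧
      ∀ m n, m < n → f m (e n) = 0 := by
  obtain ⟨g, hg, hg'⟩ := exists_seq_of_forall_finset_exists
    (fun a : X × StrongDual 𝕜 X => ‖a.1‖ = 1 ∧ a.2 a.1 = 1) (fun a b => a.2 b.1 = 0) (by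
      intro s _
      let T : X →ₗ[𝕜] (s → 𝕜) := LinearMap.pi fun a => (a.1.2 : X →ₗ[𝕜] 𝕜)
      have hT : ¬ Function.Injective T := fun h => hX (FiniteDimensional.of_injective T h)
      rw [← LinearMap.ker_eq_bot, ← ne_eq, Submodule.ne_bot_iff] at hT
      obtain ⟨x, hx, hx0⟩ := hT
      have hn : ‖x‖ ≠ 0 := norm_ne_zero_iff.2 hx0
      have hy : ‖(((‖x‖⁻¹ : ℝ) : 𝕜) • x)‖ = 1 := by
        rw [norm_smul, RCLike.norm_ofReal, abs_of_nonneg (by positivity), inv_mul_cancel₀ hn]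
      obtain ⟨f, _, hf⟩ := exists_dual_vector 𝕜 (((‖x‖⁻¹ : ℝ) : 𝕜) • x) (by rw [hy]; norm_num)
      refine ⟨(_, f), ⟨hy, by rw [hf, hy]; simp⟩, fun a ha => ?_⟩
      have : a.2 x = 0 := congrFun (LinearMap.mem_ker.1 hx) ⟨a, ha⟩
      change a.2 (_ • x) = 0
      rw [map_smul, this, smul_zero])
  exact ⟨fun n => (g n).1, fun n => (g n).2, fun n => (hg n).1, fun n => (hg n).2, hg'⟩

/-- For a triangular system `(e n, f n)` with unit vectors `e n`, the vectors
`∑ n, (t ^ n / n!) • e n`, indexed by scalars `t`, are linearly independent. -/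
theorem lift_cardinalMk_le_rank {𝕜 : Type u} {X : Type v} [RCLike 𝕜] [NormedAddCommGroup X]
    [NormedSpace 𝕜 X] [CompleteSpace X] (hX : ¬ FiniteDimensional 𝕜 X) :
    Cardinal.lift.{v} (Cardinal.mk 𝕜) ≤ Cardinal.lift.{u} (Module.rank 𝕜 X) := by
  obtain ⟨e, f, he, hf, hfe⟩ := exists_triangular_system hX
  have hsum (t : 𝕜) : Summable fun n : ℕ => (t ^ n / (n.factorial : 𝕜)) • e n := by
    refine Summable.of_norm ((Real.summable_pow_div_factorial ‖t‖).congr fun n => ?_)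
    rw [norm_smul, he, mul_one, norm_div, norm_pow, RCLike.norm_natCast]
  let x (t : 𝕜) : X := ∑' n : ℕ, (t ^ n / (n.factorial : 𝕜)) • e n
  suffices LinearIndependent 𝕜 x from this.cardinal_lift_le_rank
  rw [linearIndependent_iff']
  intro s c hc
  -- Triangularity forces all the moments `∑ t, c t * t ^ n` to vanish.
  have hmom (m : ℕ) : ∑ t ∈ s, c t * t ^ m = 0 := by
    have hS : HasSum (fun n : ℕ => ((∑ t ∈ s, c t * t ^ n) / (n.factorial : 𝕜)) • e n) 0 := by
      rw [← hc]
      refine (hasSum_sum fun t _ => ((hsum t).hasSum.const_smul (c t))).congr_fun fun n => ?_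
      simp_rw [smul_smul, ← Finset.sum_smul, Finset.sum_div, mul_div_assoc]
    induction m using Nat.strong_induction_on with
    | _ m ih =>
      have h1 := hS.mapL (f m)
      have h2 := hasSum_single (f := fun n : ℕ =>
        f m (((∑ t ∈ s, c t * t ^ n) / (n.factorial : 𝕜)) • e n)) m (fun n hn => by
          rcases lt_or_gt_of_ne hn with h | h
          · simp [ih n h]
          · simp [hfe m n h])
      have h3 := h1.unique h2
      rw [map_zero, map_smul, hf, smul_eq_mul, mul_one] at h3
      exact (div_eq_zero_iff.1 h3.symm).resolve_right (by exact_mod_cast m.factorial_ne_zero)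
  -- The geometric sequences `n ↦ t ^ n` are distinct characters of `ℕ`.
  have hinj : Function.Injective (powersHom 𝕜) := (powersHom 𝕜).injective
  have hli := (linearIndependent_monoidHom (Multiplicative ℕ) 𝕜).comp _ hinj
  rw [linearIndependent_iff'] at hli
  refine hli s c (funext fun n => ?_)
  simpa using hmom n.toAdd

/-- A maximal `1`-separated subset of the ball of radius `3` spans a dense subspace,
by Riesz' lemma. -/
theorem exists_separated_dense_span (𝕜 X : Type*) [RCLike 𝕜] [NormedAddCommGroup X]
    [NormedSpace 𝕜 X] :
    ∃ S : Set X, (∀ x ∈ S, ‖x‖ ≤ 3) ∧ S.Pairwise (fun x y => 1 ≤ ‖x - y‖) ∧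
      (Submodule.span 𝕜 S).topologicalClosure = ⊤ := by
  obtain ⟨S, hS⟩ := zorn_subset
    {S : Set X | (∀ x ∈ S, ‖x‖ ≤ 3) ∧ S.Pairwise (fun x y => 1 ≤ ‖x - y‖)} (by
      intro c hc hch
      refine ⟨⋃₀ c, ⟨?_, ?_⟩, fun s => Set.subset_sUnion_of_mem⟩
      · rintro x ⟨s, hs, hxs⟩
        exact (hc hs).1 x hxs
      · exact (Set.pairwise_sUnion hch.directedOn).2 fun s hs => (hc hs).2)
  refine ⟨S, hS.prop.1, hS.prop.2, ?_⟩
  by_contra hne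
  obtain ⟨x, hx⟩ : ∃ x, x ∉ (Submodule.span 𝕜 S).topologicalClosure := by
    simpa [Submodule.eq_top_iff'] using hne
  obtain ⟨y, hy3, hy⟩ := riesz_lemma_of_norm_lt (c := (2 : 𝕜)) (R := 3) (by simp) (by
    rw [RCLike.norm_ofNat]; norm_num) (Submodule.isClosed_topologicalClosure _) ⟨x, hx⟩
  have hyS : ∀ z ∈ S, 1 ≤ ‖y - z‖ := fun z hz =>
    hy z (Submodule.le_topologicalClosure _ (Submodule.subset_span hz))
  have hmem : y ∈ S := by
    refine hS.le_of_ge (y := insert y S) ⟨?_, ?_⟩ (Set.subset_insert y S) (Set.mem_insert y S)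
    · rintro z (rfl | hz)
      exacts [hy3, hS.prop.1 z hz]
    · refine hS.prop.2.insert fun z hz _ => ⟨hyS z hz, ?_⟩
      rw [norm_sub_rev]
      exact hyS z hz
  have := hyS y hmem
  simp at this
  linarith

/-- The map `s ↦ ∑ n, 8⁻ⁿ s n` on sequences in `S` is injective: if two values agree, then the
first terms differ by at most `6 / 7 < 1`, so they coincide, and the same holds for the shifted
sequences. -/
theorem cardinalMk_nat_fun_le_of_separated (𝕜 : Type*) {X : Type*} [RCLike 𝕜] [NormedAddCommGroup X]
    [NormedSpace 𝕜 X] [CompleteSpace X] {S : Set X} (hb : ∀ x ∈ S, ‖x‖ ≤ 3)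
    (hs : S.Pairwise (fun x y => 1 ≤ ‖x - y‖)) : Cardinal.mk (ℕ → S) ≤ Cardinal.mk X := by
  let _ : NormedSpace ℝ X := NormedSpace.restrictScalars ℝ 𝕜 X
  have hgeo : HasSum (fun n : ℕ => (3 : ℝ) * (1 / 8) ^ n) (3 * (1 - 1 / 8)⁻¹) :=
    (hasSum_geometric_of_lt_one (by norm_num) (by norm_num)).mul_left 3
  have hle (u : ℕ → S) (n : ℕ) : ‖((1 / 8 : ℝ) ^ n) • (u n : X)‖ ≤ 3 * (1 / 8) ^ n := by
    rw [norm_smul, norm_pow, Real.norm_of_nonneg (by norm_num), mul_comm]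
    exact mul_le_mul_of_nonneg_right (hb _ (u n).2) (by positivity)
  let F (u : ℕ → S) : X := ∑' n : ℕ, ((1 / 8 : ℝ) ^ n) • (u n : X)
  have hF (u : ℕ → S) : ‖F u‖ ≤ 24 / 7 := by
    refine (tsum_of_norm_bounded hgeo (hle u)).trans ?_
    norm_num
  have hrec (u : ℕ → S) : F u = u 0 + (1 / 8 : ℝ) • F (fun n => u (n + 1)) := by
    have hsum := Summable.of_norm_bounded hgeo.summable (hle u)
    change (∑' n : ℕ, ((1 / 8 : ℝ) ^ n) • (u n : X)) = _
    rw [hsum.tsum_eq_zero_add, pow_zero, one_smul, ← tsum_const_smul'']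
    simp_rw [smul_smul, ← pow_succ']
  have hstep (u v : ℕ → S) (h : F u = F v) :
      u 0 = v 0 ∧ F (fun n => u (n + 1)) = F (fun n => v (n + 1)) := by
    rw [hrec u, hrec v] at h
    have h0 : u 0 = v 0 := by
      by_contra hne
      have h1 := hs (u 0).2 (v 0).2 (fun h => hne (Subtype.ext h))
      have h2 : (u 0 : X) - v 0 =
          (1 / 8 : ℝ) • (F (fun n => v (n + 1)) - F (fun n => u (n + 1))) := by
        rw [smul_sub, sub_eq_sub_iff_add_eq_add, h, add_comm]
      beta_reduce at h1
      rw [h2, norm_smul, Real.norm_of_nonneg (by norm_num)] at h1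
      have h3 := norm_sub_le (F (fun n => v (n + 1))) (F (fun n => u (n + 1)))
      have h4 := hF (fun n => v (n + 1))
      have h5 := hF (fun n => u (n + 1))
      linarith
    refine ⟨h0, ?_⟩
    rw [h0, add_right_inj] at h
    exact smul_right_injective X (by norm_num : (1 / 8 : ℝ) ≠ 0) h
  refine Cardinal.mk_le_of_injective (f := F) fun u v huv => funext fun n => ?_
  induction n generalizing u v with
  | zero => exact (hstep u v huv).1
  | succ n ih => exact ih _ _ (hstep u v huv).2

/-- With `S` a maximal separated set in a ball, `#X = #S ^ ℵ₀`, and `ℵ₀ * ℵ₀ = ℵ₀`. -/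
theorem cardinalMk_nat_fun_eq {𝕜 : Type u} {X : Type v} [RCLike 𝕜] [NormedAddCommGroup X]
    [NormedSpace 𝕜 X] [CompleteSpace X] (hX : ¬ FiniteDimensional 𝕜 X) :
    Cardinal.mk (ℕ → X) = Cardinal.mk X := by
  obtain ⟨S, hb, hs, hd⟩ := exists_separated_dense_span 𝕜 X
  have hinf : Infinite S := by
    by_contra hfin
    rw [not_infinite_iff_finite] at hfin
    have : FiniteDimensional 𝕜 (Submodule.span 𝕜 S) := FiniteDimensional.span_of_finite 𝕜 hfin
    rw [(Submodule.closed_of_finiteDimensional _).submodule_topologicalClosure_eq] at hd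
    rw [hd] at this
    exact hX (Module.Finite.equiv (Submodule.topEquiv (R := 𝕜) (M := X)))
  -- A point is determined by a sequence of linear combinations of elements of `S` tending to it.
  have hlim (x : X) : ∃ u : ℕ → S →₀ 𝕜, Filter.Tendsto
      (fun n => Finsupp.linearCombination 𝕜 ((↑) : S → X) (u n)) Filter.atTop (𝓝 x) := by
    have hx : x ∈ closure (Submodule.span 𝕜 S : Set X) := by
      rw [← Submodule.topologicalClosure_coe, hd]
      trivial
    obtain ⟨w, hw, hwx⟩ := mem_closure_iff_seq_limit.1 hx
    choose u hu using fun n => (Finsupp.mem_span_iff_linearCombination 𝕜 S (w n)).1 (hw n)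
    exact ⟨u, by simpa only [hu] using hwx⟩
  choose u hu using hlim
  have hinj : Function.Injective u := fun x y hxy =>
    tendsto_nhds_unique (hu x) (by rw [hxy]; exact hu y)
  have hS : Cardinal.aleph0 ≤ Cardinal.lift.{u} (Cardinal.mk S) := by simp
  have hk : Cardinal.lift.{v} (Cardinal.mk 𝕜) ≤
      Cardinal.lift.{u} (Cardinal.mk S) ^ Cardinal.aleph0 := by
    refine (Cardinal.lift_le_continuum.2 (RCLike.cardinalMk_le_continuum 𝕜)).trans ?_
    rw [← Cardinal.two_power_aleph0]
    exact Cardinal.power_le_power_right ((Cardinal.natCast_lt_aleph0 (n := 2)).le.trans hS)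
  have h1 : Cardinal.mk X ≤ Cardinal.mk S ^ Cardinal.aleph0 := by
    have h := Cardinal.lift_mk_le_lift_mk_of_injective hinj
    rw [← Cardinal.lift_le.{u}]
    simp only [Cardinal.mk_arrow, Cardinal.mk_finsupp_lift_of_infinite, Cardinal.mk_nat,
      Cardinal.lift_aleph0, Cardinal.lift_max, Cardinal.lift_lift, Cardinal.lift_power,
      Cardinal.lift_id'] at h ⊢
    rw [Cardinal.lift_umax.{v, u}] at h
    refine h.trans ((Cardinal.power_le_power_right (max_le (Cardinal.self_le_power _
      Cardinal.one_le_aleph0) hk)).trans ?_)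
    rw [← Cardinal.power_mul, Cardinal.aleph0_mul_aleph0]
  have h2 := cardinalMk_nat_fun_le_of_separated 𝕜 hb hs
  simp only [Cardinal.mk_arrow, Cardinal.mk_nat, Cardinal.lift_aleph0,
    Cardinal.lift_uzero] at h2 ⊢
  rw [le_antisymm h1 h2, ← Cardinal.power_mul, Cardinal.aleph0_mul_aleph0]

/-- The Hamel dimension of an infinite-dimensional Banach space is the number of its sequences. -/
theorem rank_eq_cardinalMk_nat_fun {𝕜 X : Type*} [RCLike 𝕜] [NormedAddCommGroup X]
    [NormedSpace 𝕜 X] [CompleteSpace X] (hX : ¬ FiniteDimensional 𝕜 X) :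
    Module.rank 𝕜 X = Cardinal.mk (ℕ → X) := by
  rw [cardinalMk_nat_fun_eq hX]
  let b := Module.Free.chooseBasis 𝕜 X
  have hk := lift_cardinalMk_le_rank hX
  rw [b.mk_eq_rank''.symm] at hk ⊢
  have : Nonempty (Module.Free.ChooseBasisIndex 𝕜 X) := by
    by_contra h
    rw [not_nonempty_iff] at h
    exact hX (Module.Finite.of_basis b)
  have h := Cardinal.lift_mk_eq'.2 ⟨b.repr.toEquiv⟩
  rw [Cardinal.mk_finsupp_lift_of_infinite', max_eq_left hk] at h
  simpa using h.symm

/-! ### Scalar sequences -/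

/-- The differences of `1 / log n` have a telescoping sum, and they are of order `1 / (n log² n)`,
hence eventually above `n ^ (-1 / r)` for every `0 < r < 1`. -/
theorem exists_summable_forall_not_summable_rpow :
    ∃ b : ℕ → ℝ, (∀ n, 0 < b n) ∧ Summable b ∧
      ∀ r : ℝ, 0 < r → r < 1 → ¬ Summable fun n => b n ^ r := by
  have hl (n : ℕ) : 0 < Real.log ((n : ℝ) + 2) :=
    Real.log_pos (by linarith [n.cast_nonneg (α := ℝ)])
  have hlt (n : ℕ) : Real.log ((n : ℝ) + 2) < Real.log ((n : ℝ) + 3) :=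
    Real.log_lt_log (by positivity) (by linarith)
  let b (n : ℕ) : ℝ := (Real.log ((n : ℝ) + 2))⁻¹ - (Real.log ((n : ℝ) + 3))⁻¹
  have hpos (n : ℕ) : 0 < b n := sub_pos.2 (inv_strictAnti₀ (hl n) (hlt n))
  refine ⟨b, hpos, ?_, fun r hr hr1 hsum => ?_⟩
  · refine summable_of_sum_range_le (c := (Real.log 2)⁻¹) (fun n => (hpos n).le) fun n => ?_
    have : ∀ i : ℕ, b i = (fun n : ℕ => (Real.log ((n : ℝ) + 2))⁻¹) i
        - (fun n : ℕ => (Real.log ((n : ℝ) + 2))⁻¹) (i + 1) := fun i => by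
      simp only [b]; push_cast; ring_nf
    simp_rw [this, Finset.sum_range_sub']
    have := (inv_pos.2 (hl n)).le
    rw [Nat.cast_zero, zero_add]
    linarith
  · -- `b n ≥ 1 / ((n + 3) * log (n + 3) ^ 2)`, since `log (n + 3) - log (n + 2) ≥ 1 / (n + 3)`.
    have hb (n : ℕ) : (((n : ℝ) + 3) * Real.log ((n : ℝ) + 3) ^ (2 : ℝ))⁻¹ ≤ b n := by
      have h3 : (0 : ℝ) < n + 3 := by positivity
      have h1 : ((n : ℝ) + 3)⁻¹ ≤ Real.log ((n : ℝ) + 3) - Real.log ((n : ℝ) + 2) := by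
        have := Real.one_sub_inv_le_log_of_pos (x := ((n : ℝ) + 3) / (n + 2)) (by positivity)
        rw [Real.log_div (by positivity) (by positivity)] at this
        refine le_trans (le_of_eq ?_) this
        field_simp
        ring
      have hL := (hl n).trans (hlt n)
      have h2 : b n = (Real.log ((n : ℝ) + 3) - Real.log ((n : ℝ) + 2)) *
          ((Real.log ((n : ℝ) + 2))⁻¹ * (Real.log ((n : ℝ) + 3))⁻¹) := by
        have := (hl n).ne'
        have := hL.ne'
        simp only [b]
        field_simp
      rw [h2, mul_inv, Real.rpow_two, sq, mul_inv]
      exact mul_le_mul h1 (mul_le_mul_of_nonneg_right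
        (inv_anti₀ (hl n) (hlt n).le) (inv_pos.2 hL).le) (by positivity) (sub_pos.2 (hlt n)).le
    -- For large `x`, `log x ^ (2 * r) ≤ x ^ (1 - r)`, so that `b n ^ r ≥ 1 / (n + 3)` eventually.
    have hev : ∀ᶠ n : ℕ in Filter.atTop, ((n : ℝ) + 3)⁻¹ ≤ b n ^ r := by
      have ho := (isLittleO_log_rpow_rpow_atTop (2 * r) (sub_pos.2 hr1)).bound one_pos
      have ht : Filter.Tendsto (fun n : ℕ => (n : ℝ) + 3) Filter.atTop Filter.atTop :=
        Filter.tendsto_atTop_add_const_right _ 3 tendsto_natCast_atTop_atTop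
      filter_upwards [ht.eventually ho] with n hn
      have hL := (hl n).trans (hlt n)
      have h3 : (0 : ℝ) < n + 3 := by positivity
      rw [one_mul, Real.norm_of_nonneg (by positivity), Real.norm_of_nonneg (by positivity)] at hn
      refine le_trans ?_ (Real.rpow_le_rpow (by positivity) (hb n) hr.le)
      rw [Real.inv_rpow (by positivity), Real.mul_rpow h3.le (by positivity), ← Real.rpow_mul hL.le]
      refine inv_anti₀ (by positivity) ?_
      calc ((n : ℝ) + 3) ^ r * Real.log ((n : ℝ) + 3) ^ (2 * r)
          ≤ ((n : ℝ) + 3) ^ r * ((n : ℝ) + 3) ^ (1 - r) := by gcongr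
        _ = (n : ℝ) + 3 := by rw [← Real.rpow_add h3]; simp
    have h := hsum.of_norm_bounded_eventually_nat (f := fun n : ℕ => ((n : ℝ) + 3)⁻¹) (by
      filter_upwards [hev] with n hn
      rwa [Real.norm_of_nonneg (by positivity)])
    refine Real.not_summable_natCast_inv ((summable_nat_add_iff 3).1 ?_)
    simpa using h

/-- The sequence `1 / log n` tends to `0` slower than every negative power of `n`. -/
theorem exists_tendsto_zero_forall_not_summable_rpow :
    ∃ a : ℕ → ℝ, (∀ n, 0 < a n) ∧ Filter.Tendsto a Filter.atTop (𝓝 0) ∧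
      ∀ q : ℝ, 0 < q → ¬ Summable fun n => a n ^ q := by
  have ht : Filter.Tendsto (fun n : ℕ => (n : ℝ) + 2) Filter.atTop Filter.atTop :=
    Filter.tendsto_atTop_add_const_right _ 2 tendsto_natCast_atTop_atTop
  have hl (n : ℕ) : 0 < Real.log ((n : ℝ) + 2) :=
    Real.log_pos (by linarith [n.cast_nonneg (α := ℝ)])
  refine ⟨fun n => (Real.log ((n : ℝ) + 2))⁻¹, fun n => inv_pos.2 (hl n),
    (Real.tendsto_log_atTop.comp ht).inv_tendsto_atTop, fun q _ hsum => ?_⟩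
  have ho := (isLittleO_log_rpow_rpow_atTop q one_pos).bound one_pos
  have h := hsum.of_norm_bounded_eventually_nat (f := fun n : ℕ => ((n : ℝ) + 2)⁻¹) (by
    filter_upwards [ht.eventually ho] with n hn
    have := hl n
    rw [one_mul, Real.rpow_one, Real.norm_of_nonneg (by positivity),
      Real.norm_of_nonneg (by positivity)] at hn
    rw [Real.norm_of_nonneg (by positivity), Real.inv_rpow this.le]
    exact inv_anti₀ (by positivity) hn)
  refine Real.not_summable_natCast_inv ((summable_nat_add_iff 2).1 ?_)
  simpa using h

/-! ### Membership in `ℓ_q` of a scalar sequence times a vector -/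

theorem memℓp_smul_iff {𝕜 X : Type*} [RCLike 𝕜] [NormedAddCommGroup X] [NormedSpace 𝕜 X]
    {a : ℕ → ℝ} (ha : ∀ n, 0 < a n) {x : X} (hx : x ≠ 0) {q : ℝ≥0} (hq : 0 < q) :
    Memℓp (fun n => (a n : 𝕜) • x) (q : ℝ≥0∞) ↔ Summable fun n => a n ^ (q : ℝ) := by
  rw [memℓp_gen_iff (by simpa using hq), ENNReal.coe_toReal]
  have hx' : ‖x‖ ^ (q : ℝ) ≠ 0 := (Real.rpow_pos_of_pos (norm_pos_iff.2 hx) _).ne'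
  rw [← summable_mul_right_iff (f := fun n => a n ^ (q : ℝ)) hx']
  refine summable_congr fun n => ?_
  rw [norm_smul, RCLike.norm_ofReal, abs_of_pos (ha n), Real.mul_rpow (ha n).le (norm_nonneg x)]

theorem memℓp_smul {𝕜 X : Type*} [RCLike 𝕜] [NormedAddCommGroup X] [NormedSpace 𝕜 X]
    {a : ℕ → ℝ} (ha : ∀ n, 0 < a n) (x : X) {q : ℝ≥0} (hq : 0 < q)
    (h : Summable fun n => a n ^ (q : ℝ)) : Memℓp (fun n => (a n : 𝕜) • x) (q : ℝ≥0∞) := by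
  rcases eq_or_ne x 0 with rfl | hx
  · simp only [smul_zero]
    exact zero_memℓp
  · exact (memℓp_smul_iff ha hx hq).2 h

/-! ### Spaceability along a scalar sequence -/

/-- Let `E` be a space of `X`-valued sequences with continuous coordinates that contains
`(a n • x)` for all `x`. These sequences are the `y` in `E` with `a 0 • y n = a n • y 0`,
so they form a closed subspace. -/
theorem rank_eq_and_isMaximalSpaceable {𝕜 : Type*} {X E : Type v} [RCLike 𝕜] [NormedAddCommGroup X]
    [NormedSpace 𝕜 X] [CompleteSpace X] (hX : ¬ FiniteDimensional 𝕜 X)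
    [AddCommGroup E] [Module 𝕜 E] (τ : TopologicalSpace E) (ev : E →ₗ[𝕜] ℕ → X)
    (hev : Function.Injective ev) (hcont : ∀ n, Continuous[τ, _] fun y => ev y n)
    {a : ℕ → ℝ} (ha : ∀ n, 0 < a n) (hE : ∀ x : X, ∃ y, ev y = fun n => (a n : 𝕜) • x)
    {A : Set E} (hA : ∀ y x, x ≠ 0 → ev y = (fun n => (a n : 𝕜) • x) → y ∈ A) :
    Module.rank 𝕜 E = Module.rank 𝕜 X ∧ IsMaximalSpaceable 𝕜 τ A := by
  have ha0 (n : ℕ) : (a n : 𝕜) ≠ 0 := RCLike.ofReal_ne_zero.2 (ha n).ne'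
  let W : Submodule 𝕜 E :=
    { carrier := {y | ∀ n, (a 0 : 𝕜) • ev y n = (a n : 𝕜) • ev y 0}
      add_mem' := fun {y z} hy hz n => by simp [smul_add, hy n, hz n]
      zero_mem' := fun n => by simp
      smul_mem' := fun c y hy n => by
        simp only [map_smul, Pi.smul_apply]
        rw [smul_comm, hy n, smul_comm] }
  have hW (y : E) (hy : y ∈ W) : ev y = fun n => (a n : 𝕜) • ((a 0 : 𝕜)⁻¹ • ev y 0) :=
    funext fun n => by rw [smul_comm, ← hy n, inv_smul_smul₀ (ha0 0)]
  have hWmem (x : X) (y : E) (h : ev y = fun n => (a n : 𝕜) • x) : y ∈ W := fun n => by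
    rw [h]
    exact smul_comm _ _ _
  choose y hy using hE
  let T : X →ₗ[𝕜] W :=
    { toFun := fun x => ⟨y x, hWmem x _ (hy x)⟩
      map_add' := fun x x' => Subtype.ext <| hev <| by
        simp [hy, funext_iff, smul_add]
      map_smul' := fun c x => Subtype.ext <| hev <| by
        simp [hy, funext_iff, smul_comm c] }
  have hT : Function.Injective T := fun x x' h => by
    have h1 : ev (y x) = ev (y x') := congrArg (fun w : W => ev w) h
    rw [hy, hy] at h1
    exact smul_right_injective X (ha0 0) (congrFun h1 0)
  have h1 : Module.rank 𝕜 X ≤ Module.rank 𝕜 W := LinearMap.rank_le_of_injective T hT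
  have h2 : Module.rank 𝕜 W ≤ Module.rank 𝕜 E := W.rank_le
  have h3 : Module.rank 𝕜 E ≤ Module.rank 𝕜 X := by
    rw [rank_eq_cardinalMk_nat_fun hX]
    exact rank_le_card 𝕜 E |>.trans (Cardinal.mk_le_of_injective hev)
  refine ⟨h3.antisymm (h1.trans h2), W, ?_, h2.antisymm (h3.trans h1), fun z hz => ?_⟩
  · have : (W : Set E) = ⋂ n, {z | (a 0 : 𝕜) • ev z n = (a n : 𝕜) • ev z 0} := by
      ext z
      simp [W]
    rw [this]
    exact isClosed_iInter fun n =>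
      isClosed_eq ((hcont n).const_smul _) ((hcont 0).const_smul _)
  · rcases eq_or_ne ((a 0 : 𝕜)⁻¹ • ev z 0) 0 with h | h
    · refine Or.inr (hev ?_)
      rw [hW z hz, h, map_zero]
      simp [funext_iff]
    · exact Or.inl (hA z _ h (hW z hz))

/-! ### The three sequence spaces -/

theorem continuous_ellPTopology_apply (X : Type*) [NormedAddCommGroup X] {p : ℝ≥0} (hp : 0 < p)
    (n : ℕ) : Continuous[ellPTopology X p, _] fun y : EllP X p => y n := by
  let _ := ellPTopology X p
  refine continuous_def.2 fun U hU y hy => ?_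
  obtain ⟨ε, hε, h⟩ := Metric.isOpen_iff.1 hU _ hy
  refine ⟨ε, hε, fun z hz => h ?_⟩
  rw [mem_ball_iff_norm]
  exact (lp.norm_apply_le_norm (ENNReal.coe_ne_zero.2 hp.ne') (z - y) n).trans_lt hz

theorem mainTheorem2 {𝕜 X : Type*} [RCLike 𝕜] [NormedAddCommGroup X] [NormedSpace 𝕜 X]
    [CompleteSpace X] (hX : ¬ FiniteDimensional 𝕜 X) :
    (∀ p : ℝ≥0, 0 < p →
      Module.rank 𝕜 (EllP X p) = Module.rank 𝕜 X ∧
      IsMaximalSpaceable 𝕜 (ellPTopology X p)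
        {x : EllP X p | ¬ ∃ q : ℝ≥0, 0 < q ∧ q < p ∧ Memℓp (x : ℕ → X) (q : ℝ≥0∞)}) ∧
    (Module.rank 𝕜 C₀(ℕ, X) = Module.rank 𝕜 X ∧
      IsMaximalSpaceable 𝕜 (inferInstance : TopologicalSpace C₀(ℕ, X))
        {x : C₀(ℕ, X) | ¬ ∃ q : ℝ≥0, 0 < q ∧ Memℓp (x : ℕ → X) (q : ℝ≥0∞)}) ∧
    (∀ p : ℝ≥0, 1 ≤ p →
      Module.rank 𝕜 (ellPlus 𝕜 X p) = Module.rank 𝕜 X ∧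
      IsMaximalSpaceable 𝕜 (ellPlusTopology 𝕜 X p)
        {x : ellPlus 𝕜 X p | ¬ Memℓp (x.1 : ℕ → X) (p : ℝ≥0∞)}) := by
  refine ⟨fun p hp => ?_, ?_, fun p hp => ?_⟩
  · -- The scalar sequence is `b ^ (1 / p)`, with `b` summable but `b ^ r` not, for `0 < r < 1`.
    obtain ⟨b, hb, hsum, hnot⟩ := exists_summable_forall_not_summable_rpow
    have ha (n : ℕ) : 0 < b n ^ (p : ℝ)⁻¹ := Real.rpow_pos_of_pos (hb n) _
    have hp' : (0 : ℝ) < p := hp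
    refine rank_eq_and_isMaximalSpaceable hX _
      { toFun := fun y : EllP X p => (y : ℕ → X)
        map_add' := fun _ _ => rfl
        map_smul' := fun _ _ => rfl } (fun _ _ h => Subtype.ext h)
      (continuous_ellPTopology_apply X hp) ha (fun x => ⟨⟨_, memℓp_smul ha x hp ?_⟩, rfl⟩) ?_
    · refine hsum.congr fun n => ?_
      rw [← Real.rpow_mul (hb n).le, inv_mul_cancel₀ hp'.ne', Real.rpow_one]
    · rintro y x hx hyx ⟨q, hq, hqp, hmem⟩
      have hq' : (0 : ℝ) < q := hq
      have hyx' : (y : ℕ → X) = _ := hyx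
      rw [hyx', memℓp_smul_iff ha hx hq] at hmem
      refine hnot (q / p) (by positivity) ((div_lt_one hp').2 hqp) (hmem.congr fun n => ?_)
      rw [← Real.rpow_mul (hb n).le, inv_mul_eq_div]
  · obtain ⟨a, ha, hlim, hnot⟩ := exists_tendsto_zero_forall_not_summable_rpow
    refine rank_eq_and_isMaximalSpaceable hX _
      { toFun := fun y : C₀(ℕ, X) => (y : ℕ → X)
        map_add' := fun _ _ => rfl
        map_smul' := fun _ _ => rfl } (fun _ _ h => DFunLike.coe_injective h) (fun n => ?_) ha
      (fun x => ⟨⟨⟨_, continuous_of_discreteTopology⟩, ?_⟩, rfl⟩) ?_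
    · exact (BoundedContinuousFunction.lipschitz_eval_const (β := X) n).continuous.comp
        (ZeroAtInftyContinuousMap.isometry_toBCF (α := ℕ) (β := X)).continuous
    · rw [cocompact_eq_atTop]
      have h1 : Filter.Tendsto (fun n => (a n : 𝕜)) Filter.atTop (𝓝 0) := by
        have h := ((RCLike.continuous_ofReal (K := 𝕜)).tendsto 0).comp hlim
        rwa [RCLike.ofReal_zero] at h
      have h2 := h1.smul_const x
      rwa [zero_smul] at h2
    · rintro y x hx hyx ⟨q, hq, hmem⟩
      have hyx' : (y : ℕ → X) = _ := hyx
      rw [hyx', memℓp_smul_iff ha hx hq] at hmem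
      exact hnot q hq hmem
  · -- The scalar sequence is `(n + 1) ^ (-1 / p)`.
    have hp0 : 0 < p := one_pos.trans_le hp
    have hp' : (0 : ℝ) < p := hp0
    have ha (n : ℕ) : 0 < ((n : ℝ) + 1) ^ (-(p : ℝ)⁻¹) := Real.rpow_pos_of_pos (by positivity) _
    have hsum (q : ℝ≥0) : (Summable fun n : ℕ => (((n : ℝ) + 1) ^ (-(p : ℝ)⁻¹)) ^ (q : ℝ)) ↔
        p < q := by
      have h := summable_nat_add_iff (f := fun n : ℕ => (n : ℝ) ^ (-((q : ℝ) / p))) 1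
      rw [Real.summable_nat_rpow, neg_lt_neg_iff, one_lt_div hp', NNReal.coe_lt_coe] at h
      rw [← h]
      refine summable_congr fun n => ?_
      rw [← Real.rpow_mul (by positivity), Nat.cast_add_one, neg_mul, inv_mul_eq_div]
    refine rank_eq_and_isMaximalSpaceable hX _
      { toFun := fun y : ellPlus 𝕜 X p => (y.1 : ℕ → X)
        map_add' := fun _ _ => rfl
        map_smul' := fun _ _ => rfl } (fun _ _ h => Subtype.ext h) (fun n => ?_) ha
      (fun x => ⟨⟨_, (Submodule.mem_iInf _).2 fun q =>
        memℓp_smul ha x (hp0.trans q.2) ((hsum q.1).2 q.2)⟩, rfl⟩) ?_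
    · -- The coordinates are continuous already for the norm of one `ℓ_q(X)`.
      let q : {q : ℝ≥0 // p < q} := ⟨p + 1, lt_add_one p⟩
      have h1 : Continuous[ellPlusTopology 𝕜 X p, ellPTopology X q.1] (ellPlusIncl 𝕜 X p q) :=
        continuous_iff_le_induced.2 (iInf_le _ q)
      exact @Continuous.comp _ _ _ (_) (_) (_) _ _
        (continuous_ellPTopology_apply X (hp0.trans q.2) n) h1
    · intro y x hx hyx hmem
      have hyx' : (y.1 : ℕ → X) = _ := hyx
      rw [hyx', memℓp_smul_iff ha hx hp0, hsum] at hmem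
      exact lt_irrefl p hmem
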